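/- For $N\ge 1$ let $\mathcal{W}_N=\{0,1,\dots,N-1\}^{\mathbb{N}}$ be the set of infinite words on $N$ symbols with the lexicographic order, and let $\Sigma_N:\mathcal{W}_N\to\mathcal{W}_N$, $w_1w_2w_3\dots\mapsto w_2w_3w_4\dots$, be the one-sided shift. A permutation $\pi$ of $\{1,\dots,n\}$ is realized by $\Sigma_N$ if there is $w\in\mathcal{W}_N$ such that, for all $1\le i,j\le n$, $\Sigma_N^{i-1}(w)<\Sigma_N^{j-1}(w)$ if and only if $\pi(i)<\pi(j)$. Let $N(\pi)$ be the smallest $N$ such that $\pi$ is realized by $\Sigma_N$, and let $a_{n,N}$ be the number of permutations $\pi$ of $\{1,\dots,n\}$ with $N(\pi)=N$. A finite word is primitive if it is not of the form $u^m$ (the concatenation of $m$ copies of a word $u$) with $m>1$; let $\psi_M(t)$ be the number of primitive words of length $t$ over an $M$-letter alphabet. Then, for all $n,N\ge2$, $$a_{n,N}=\sum_{i=0}^{N-2}(-1)^i\binom{n}{i}\left((N-i-2)(N-i)^{n-2}+\sum_{t=1}^{n-1}\psi_{N-i}(t)\,(N-i)^{n-t-1}\right).$$ -/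

import Mathlib

namespace ShiftPatterns

/-- The set of infinite words on the symbols `0, …, N-1`, with the lexicographic order. -/
abbrev Word (N : ℕ) : Type := Lex (ℕ → Fin N)

/-- The one-sided shift `w₁w₂w₃… ↦ w₂w₃w₄…`. -/
def shift (N : ℕ) (w : Word N) : Word N :=
  toLex fun k => ofLex w (k + 1)

/-- `π` is the relative order of `x, f x, …, f^[n-1] x`, with positions and values indexed by
`Fin n`. The condition forces these `n` points to be pairwise distinct, since the
order on `X` is total and `π` is injective. -/
def HasPattern {X : Type*} [LinearOrder X] (f : X → X) (x : X) {n : ℕ}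
    (π : Equiv.Perm (Fin n)) : Prop :=
  ∀ i j : Fin n, f^[(i : ℕ)] x < f^[(j : ℕ)] x ↔ π i < π j

/-- The permutations of length `n` that are realized by `f`. -/
def allowedPatterns {X : Type*} [LinearOrder X] (f : X → X) (n : ℕ) :
    Set (Equiv.Perm (Fin n)) :=
  {π | ∃ x : X, HasPattern f x π}

/-- The smallest `N` such that `π` is realized by the shift on `N` symbols. -/
noncomputable def symbolsNeeded {n : ℕ} (π : Equiv.Perm (Fin n)) : ℕ :=
  sInf {N : ℕ | π ∈ allowedPatterns (shift N) n}

/-- The number of permutations of length `n` that need exactly `N` symbols. -/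
noncomputable def numPerms (n N : ℕ) : ℕ :=
  Nat.card {π : Equiv.Perm (Fin n) // symbolsNeeded π = N}

/-- A finite word is primitive if it is not `u^m` for any word `u` and any `m > 1`. -/
def IsPrimitive {α : Type*} (w : List α) : Prop :=
  ¬ ∃ (u : List α) (m : ℕ), 1 < m ∧ w = (List.replicate m u).flatten

/-- The number of primitive words of length `t` over an `M`-letter alphabet. -/
noncomputable def numPrimitive (M t : ℕ) : ℕ :=
  Nat.card {w : Fin t → Fin M // IsPrimitive (List.ofFn w)}

end ShiftPatterns

namespace ShiftPatterns

/-! ### Tails of infinite words -/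

/-! The proof counts in two ways the pairs of a permutation `π` and a word `U` of length n-1 over M
letters that begins an infinite word realizing `π`. Such words are described by a finite condition,
`Admissible`: the ranking is compatible with `U`, and the last letter is not extreme in the
direction in which the last tail is extreme (`mem_allowedPatterns_iff`). For sufficiency, let p be
the position ranked just below the last one. Repeating the factor of `U` from p on forever orders
the tails as `π` does, up to ties, and replacing the far end by copies of M-1 breaks the ties. If
the last position has the lowest rank, zeros are appended instead.

For fixed `U`, one compatible permutation has last rank 0. Any other is determined by p
(`rank_lt_iff`), and p occurs exactly when the suffix starting at p is primitive (`card_compat`).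
Dropping the permutations excluded by the last letter and summing over `U` gives S(M) = (M-2)M^(n-2)
+ ∑ ψ_M(t) M^(n-t-1).

For fixed `π`, reading the letters in order of rank turns admissibility into a weakly increasing
sequence with c forced unit jumps, where c does not depend on M. There are C(M-1-c+n-1, n-1) of
these if c < M and none otherwise (`exists_card_admissible`), so N(π) = c+1. Hence S(M) = ∑_N
a_{n,N} C(M-N+n-1, n-1) over N ≤ M. Multiplying generating functions by (1-X)^n inverts this
(`alternating_sum_choose`). -/

/-- The tail of `W` that starts at position `i`. -/
def tail (W : ℕ → ℕ) (i : ℕ) : Lex (ℕ → ℕ) := toLex fun k => W (i + k)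

theorem tail_lt_iff {W V : ℕ → ℕ} {i j : ℕ} :
    tail W i < tail V j ↔ ∃ k, (∀ l < k, W (i + l) = V (j + l)) ∧ W (i + k) < V (j + k) :=
  Iff.rfl

theorem tail_eq_iff {W V : ℕ → ℕ} {i j : ℕ} :
    tail W i = tail V j ↔ ∀ k, W (i + k) = V (j + k) := by
  unfold tail
  rw [toLex_inj, funext_iff]

theorem tail_lt_iff_step {W V : ℕ → ℕ} {i j : ℕ} :
    tail W i < tail V j ↔ W i < V j ∨ (W i = V j ∧ tail W (i + 1) < tail V (j + 1)) := by
  simp only [tail_lt_iff]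
  constructor
  · rintro ⟨k, h1, h2⟩
    rcases k with _ | k
    · exact Or.inl h2
    · refine Or.inr ⟨h1 0 (by omega), k, fun l hl => ?_, ?_⟩
      · have := h1 (l + 1) (by omega)
        rwa [← add_assoc, ← add_assoc, add_right_comm, add_right_comm j] at this
      · rwa [← add_assoc, ← add_assoc, add_right_comm, add_right_comm j] at h2
  · rintro (h | ⟨h, k, h1, h2⟩)
    · exact ⟨0, by simp, h⟩
    · refine ⟨k + 1, fun l hl => ?_, ?_⟩
      · rcases l with _ | l
        · exact h
        · have := h1 l (by omega)
          rwa [← add_assoc, ← add_assoc, add_right_comm, add_right_comm j]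
      · rwa [← add_assoc, ← add_assoc, add_right_comm, add_right_comm j]

theorem tail_eq_add {W V : ℕ → ℕ} {i j : ℕ} (h : tail W i = tail V j) (l : ℕ) :
    tail W (i + l) = tail V (j + l) := by
  rw [tail_eq_iff] at h ⊢
  intro k
  have := h (l + k)
  rwa [← add_assoc, ← add_assoc] at this

theorem tail_eq_iff_step {W V : ℕ → ℕ} {i j : ℕ} :
    tail W i = tail V j ↔ W i = V j ∧ tail W (i + 1) = tail V (j + 1) := by
  refine ⟨fun h => ⟨tail_eq_iff.1 h 0, tail_eq_add h 1⟩, fun ⟨h, h'⟩ => ?_⟩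
  rw [tail_eq_iff] at h' ⊢
  rintro (_ | k)
  · exact h
  · have := h' k
    rwa [← add_assoc, ← add_assoc, add_right_comm, add_right_comm j]

/-- If a tail decreases under the shift, then a letter smaller than its first one occurs later. -/
theorem exists_lt_of_tail_succ_lt {W : ℕ → ℕ} {i : ℕ} (h : tail W (i + 1) < tail W i) :
    ∃ k, W k < W i := by
  obtain ⟨k, h1, h2⟩ := tail_lt_iff.1 h
  have hc : ∀ l ≤ k, W (i + l) = W i := by
    intro l
    induction l with
    | zero => simp
    | succ l ih =>
      intro hl
      rw [← ih (by omega), ← h1 l (by omega)]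
      congr 1; omega
  exact ⟨_, h2.trans_eq (hc k le_rfl)⟩

/-- If a tail increases under the shift, then a letter larger than its first one occurs later. -/
theorem exists_gt_of_lt_tail_succ {W : ℕ → ℕ} {i : ℕ} (h : tail W i < tail W (i + 1)) :
    ∃ k, W i < W k := by
  obtain ⟨k, h1, h2⟩ := tail_lt_iff.1 h
  have hc : ∀ l ≤ k, W (i + l) = W i := by
    intro l
    induction l with
    | zero => simp
    | succ l ih =>
      intro hl
      rw [← ih (by omega), h1 l (by omega)]
      congr 1; omega
  exact ⟨_, (hc k le_rfl).symm.trans_lt h2⟩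

/-! ### Rankings of positions compatible with a finite word -/

/-- The ranking `P` of the positions `0, …, m` is compatible with the word `U 0, …, U (m - 1)`,
in the sense that it could be the ranking of the first `m + 1` tails of an infinite word that
extends `U`. -/
def Compat (m : ℕ) (P U : ℕ → ℕ) : Prop :=
  ∀ i < m, ∀ j < m, P i < P j → U i < U j ∨ (U i = U j ∧ P (i + 1) < P (j + 1))

/-- `P` ranks the positions `0, …, m` without ties. -/
def Distinct (m : ℕ) (P : ℕ → ℕ) : Prop :=
  ∀ i ≤ m, ∀ j ≤ m, P i = P j → i = j

/-- `p` is the position ranked immediately below `m`. -/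
structure IsPred (m : ℕ) (P : ℕ → ℕ) (p : ℕ) : Prop where
  lt : p < m
  rank_lt : P p < P m
  rank_le : ∀ i < m, P i < P m → P i ≤ P p

section Core

variable {m : ℕ} {P U W : ℕ → ℕ} {p : ℕ}

theorem Compat.congr (hC : Compat m P U) (h : ∀ i < m, U i = W i) : Compat m P W := by
  intro i hi j hj hij
  rw [← h i hi, ← h j hj]
  exact hC i hi j hj hij

theorem Distinct.lt_or_lt (hD : Distinct m P) {i j : ℕ} (hi : i ≤ m) (hj : j ≤ m) (h : i ≠ j) :
    P i < P j ∨ P j < P i :=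
  lt_or_gt_of_ne fun h' => h (hD i hi j hj h')

/-- If `P` is monotone for a total strict relation on positions, it is determined by it. -/
theorem Distinct.lt_iff {R : ℕ → ℕ → Prop} (hD : Distinct m P)
    (hR : ∀ i ≤ m, ∀ j ≤ m, R i j → ¬ R j i)
    (h : ∀ i ≤ m, ∀ j ≤ m, P i < P j → R i j) {i j : ℕ} (hi : i ≤ m) (hj : j ≤ m) :
    P i < P j ↔ R i j := by
  refine ⟨h i hi j hj, fun hr => ?_⟩
  by_cases hij : i = j
  · subst hij; exact absurd hr (hR i hi i hi hr)
  · rcases hD.lt_or_lt hi hj hij with h' | h'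
    · exact h'
    · exact absurd (h j hj i hi h') (hR i hi j hj hr)

/-- A compatible ranking agrees with the order of the tails once it does so in the comparisons
with position `m`. -/
theorem Compat.tail_lt (hC : Compat m P W)
    (hlo : ∀ i < m, P i < P m → tail W i < tail W m)
    (hhi : ∀ i < m, P m < P i → tail W m < tail W i) :
    ∀ i ≤ m, ∀ j ≤ m, P i < P j → tail W i < tail W j := by
  have key : ∀ d, ∀ i ≤ m, ∀ j ≤ m, m - i = d → P i < P j → tail W i < tail W j := by
    intro d
    induction d with
    | zero =>
      intro i hi j hj hd h
      have : i = m := by omega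
      subst this
      rcases hj.lt_or_eq with hj | rfl
      · exact hhi j hj h
      · exact absurd h (lt_irrefl _)
    | succ d ih =>
      intro i hi j hj hd h
      rcases hj.lt_or_eq with hj | rfl
      · rw [tail_lt_iff_step]
        rcases hC i (by omega) j hj h with h' | ⟨h', h''⟩
        · exact Or.inl h'
        · exact Or.inr ⟨h', ih _ (by omega) _ (by omega) (by omega) h''⟩
      · exact hlo i (by omega) h
  exact fun i hi j hj => key _ i hi j hj rfl

/-- Compatibility carries order forward along equal letters, so the contrapositive carries it back
along a common factor. -/
theorem Compat.lt_of_add_lt (hC : Compat m P U) (hD : Distinct m P) {i j : ℕ} :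
    ∀ l, i + l ≤ m → j + l ≤ m → (∀ a < l, U (i + a) = U (j + a)) →
      P (i + l) < P (j + l) → P i < P j := by
  intro l
  induction l with
  | zero => intro _ _ _ h; exact h
  | succ l ih =>
    intro hi hj hU h
    refine ih (by omega) (by omega) (fun a ha => hU a (by omega)) ?_
    have hne : i + l ≠ j + l := by
      intro h'
      rw [← add_assoc, ← add_assoc, h'] at h
      exact lt_irrefl _ h
    rcases hD.lt_or_lt (show i + l ≤ m by omega) (show j + l ≤ m by omega) hne with h' | h'
    · exact h'
    · rcases hC _ (by omega) _ (by omega) h' with h2 | ⟨-, h2⟩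
      · rw [hU l (by omega)] at h2; exact absurd h2 (lt_irrefl _)
      · exact absurd h (not_lt.2 h2.le)

/-! ### The periodic extension looping back to the predecessor of the last position -/

/-- The position in `[0, m)` read at time `k` when position `m` is identified with `p`. -/
def wrap (p m k : ℕ) : ℕ := if k < m then k else p + (k - p) % (m - p)

/-- The word `U 0 … U (m - 1)` followed by infinitely many copies of `U p … U (m - 1)`. -/
def periodicExt (p m : ℕ) (U : ℕ → ℕ) (k : ℕ) : ℕ := U (wrap p m k)

theorem wrap_of_lt {k : ℕ} (h : k < m) : wrap p m k = k := if_pos h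

theorem wrap_lt (hp : p < m) (k : ℕ) : wrap p m k < m := by
  unfold wrap
  split_ifs with h
  · exact h
  · have := Nat.mod_lt (k - p) (show 0 < m - p by omega)
    omega

theorem wrap_add (hp : p < m) (k : ℕ) : wrap p m (p + k) = p + k % (m - p) := by
  unfold wrap
  split_ifs with h
  · rw [Nat.mod_eq_of_lt (by omega)]
  · rw [Nat.add_sub_cancel_left]

theorem wrap_self (hp : p < m) : wrap p m m = p := by
  have := wrap_add hp (m - p)
  rwa [Nat.mod_self, Nat.add_sub_cancel' hp.le] at this

theorem wrap_succ (hp : p < m) (k : ℕ) :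
    wrap p m (k + 1) = if wrap p m k + 1 < m then wrap p m k + 1 else p := by
  by_cases hk : k < p
  · rw [wrap_of_lt (by omega), wrap_of_lt (by omega), if_pos (by omega)]
  · obtain ⟨l, rfl⟩ := Nat.exists_eq_add_of_le (not_lt.1 hk)
    rw [add_assoc, wrap_add hp, wrap_add hp]
    have h1 := Nat.mod_lt l (show 0 < m - p by omega)
    by_cases h : l % (m - p) + 1 < m - p
    · rw [if_pos (by omega), Nat.add_mod, Nat.mod_eq_of_lt (show 1 < m - p by omega),
        Nat.mod_eq_of_lt h, add_assoc]
    · rw [if_neg (by omega)]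
      have h2 : l % (m - p) + 1 = m - p := by omega
      have h3 : (l + 1) % (m - p) = (l % (m - p) + 1) % (m - p) := by simp
      rw [h3, h2, Nat.mod_self, add_zero]

theorem periodicExt_of_lt {k : ℕ} (h : k < m) : periodicExt p m U k = U k := by
  rw [periodicExt, wrap_of_lt h]

theorem tail_periodicExt_self (hp : p < m) :
    tail (periodicExt p m U) m = tail (periodicExt p m U) p := by
  rw [tail_eq_iff]
  intro k
  have h : m + k = p + (k + (m - p)) := by omega
  rw [periodicExt, periodicExt, h, wrap_add hp, wrap_add hp, Nat.add_mod_right]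

/-- Identifying m with p preserves the weak order, since no position below m has rank strictly
between those of p and m. -/
theorem wrap_step (hD : Distinct m P) (hC : Compat m P U) (hp : IsPred m P p)
    {i j : ℕ} (h : P (wrap p m i) ≤ P (wrap p m j)) :
    periodicExt p m U i ≤ periodicExt p m U j ∧
      (periodicExt p m U i = periodicExt p m U j →
        P (wrap p m (i + 1)) ≤ P (wrap p m (j + 1))) := by
  have hi := wrap_lt hp.lt i
  have hj := wrap_lt hp.lt j
  rw [wrap_succ hp.lt, wrap_succ hp.lt]
  unfold periodicExt
  generalize wrap p m i = x at *
  generalize wrap p m j = y at *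
  rcases h.lt_or_eq with h | h
  · rcases hC x hi y hj h with h' | ⟨h', h''⟩
    · exact ⟨h'.le, fun h2 => absurd h2 h'.ne⟩
    · refine ⟨h'.le, fun _ => ?_⟩
      by_cases hx : x + 1 < m
      · rw [if_pos hx]
        by_cases hy : y + 1 < m
        · rw [if_pos hy]; exact h''.le
        · rw [if_neg hy]
          have : y + 1 = m := by omega
          rw [this] at h''
          exact hp.rank_le _ hx h''
      · rw [if_neg hx]
        have : x + 1 = m := by omega
        rw [this] at h''
        by_cases hy : y + 1 < m
        · rw [if_pos hy]; exact (hp.rank_lt.trans h'').le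
        · rw [if_neg hy]
  · have := hD x hi.le y hj.le h
    subst this
    simp

theorem wrap_steps (hD : Distinct m P) (hC : Compat m P U) (hp : IsPred m P p)
    {i j : ℕ} (h : P (wrap p m i) ≤ P (wrap p m j)) :
    ∀ l, (∀ a < l, periodicExt p m U (i + a) = periodicExt p m U (j + a)) →
      P (wrap p m (i + l)) ≤ P (wrap p m (j + l)) := by
  intro l
  induction l with
  | zero => intro _; exact h
  | succ l ih =>
    intro hl
    exact (wrap_step hD hC hp (ih fun a ha => hl a (by omega))).2 (hl l (by omega))

theorem tail_le_of_wrap_le (hD : Distinct m P) (hC : Compat m P U) (hp : IsPred m P p)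
    {i j : ℕ} (h : P (wrap p m i) ≤ P (wrap p m j)) :
    tail (periodicExt p m U) i ≤ tail (periodicExt p m U) j := by
  by_contra hlt
  obtain ⟨k, h1, h2⟩ := tail_lt_iff.1 (not_le.1 hlt)
  have := wrap_steps hD hC hp h k fun a ha => (h1 a ha).symm
  exact absurd h2 (not_lt.2 (wrap_step hD hC hp this).1)

/-- This decides how ties with m are broken. A position before p is moved forward by one loop and
handled by induction; a position inside the loop ranked above m would give a cyclic chain of ranks.
-/
theorem rank_lt_of_tail_eq_tail_self (hD : Distinct m P) (hC : Compat m P U) (hp : IsPred m P p)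
    : ∀ d i, m - i = d → i < m →
    tail (periodicExt p m U) i = tail (periodicExt p m U) m → P i < P m := by
  intro d
  induction d using Nat.strong_induction_on with
  | _ d ih =>
    intro i hd hi h
    have ht : tail (periodicExt p m U) p = tail (periodicExt p m U) i := by
      rw [h, tail_periodicExt_self hp.lt]
    rcases lt_trichotomy i p with hip | rfl | hip
    · have hpm := hp.lt
      have h2 := tail_eq_add ht (m - p)
      rw [Nat.add_sub_cancel' hp.lt.le] at h2
      have h1 := ih (m - (i + (m - p))) (by omega) (i + (m - p)) rfl (by omega) h2.symm
      refine (hC.lt_of_add_lt hD (j := p) (m - p) (by omega) (by omega) (fun a ha => ?_)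
        (by rwa [Nat.add_sub_cancel' hp.lt.le])).trans hp.rank_lt
      have := tail_eq_iff.1 ht a
      rw [periodicExt_of_lt (by omega), periodicExt_of_lt (by omega)] at this
      exact this.symm
    · exact hp.rank_lt
    · by_contra hlt
      obtain ⟨a, rfl⟩ := Nat.exists_eq_add_of_lt hip
      have h0 : P p < P (p + a + 1) := by
        refine hp.rank_lt.trans_le (not_lt.1 hlt)
      -- From p on the word has period a+1, so stepping by a+1 inside the loop preserves the initial
      -- inequality P p ≤ P (p+a+1).
      have hmono : Monotone fun k => P (wrap p m (p + (a + 1) * k)) := by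
        refine monotone_nat_of_le_succ fun k => ?_
        induction k with
        | zero =>
          have h1 : wrap p m (p + (a + 1) * 0) = p := by simp [wrap_of_lt hp.lt]
          have h2 : wrap p m (p + (a + 1) * (0 + 1)) = p + a + 1 := by
            rw [zero_add, mul_one, ← add_assoc, wrap_of_lt hi]
          rw [h1, h2]; exact h0.le
        | succ k ihk =>
          have h3 := wrap_steps hD hC hp ihk (a + 1) fun l _ => by
            have h4 := tail_eq_iff.1 ht ((a + 1) * k + l)
            have e1 : p + ((a + 1) * k + l) = p + (a + 1) * k + l := by ring
            have e2 : p + a + 1 + ((a + 1) * k + l) = p + (a + 1) * (k + 1) + l := by ring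
            rwa [e1, e2] at h4
          have e1 : p + (a + 1) * k + (a + 1) = p + (a + 1) * (k + 1) := by ring
          have e2 : p + (a + 1) * (k + 1) + (a + 1) = p + (a + 1) * (k + 1 + 1) := by ring
          rwa [e1, e2] at h3
      -- After m-p steps the position is back at p, so monotonicity yields P (p+a+1) ≤ P p.
      have h5 := hmono (show 1 ≤ m - p by have := hp.lt; omega)
      simp only [wrap_add hp.lt, Nat.mul_mod_left, add_zero, mul_one] at h5
      rw [Nat.mod_eq_of_lt (by omega), ← add_assoc] at h5
      exact absurd h0 (not_lt.2 h5)

/-- Positions with equal tails are ranked from left to right. -/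
theorem rank_lt_of_tail_eq (hD : Distinct m P) (hC : Compat m P U) (hp : IsPred m P p)
    {i j : ℕ} (hij : i < j) (hj : j ≤ m)
    (h : tail (periodicExt p m U) i = tail (periodicExt p m U) j) : P i < P j := by
  have h2 := tail_eq_add h (m - j)
  rw [Nat.add_sub_cancel' hj] at h2
  have h1 := rank_lt_of_tail_eq_tail_self hD hC hp _ _ rfl (by omega) h2
  refine hC.lt_of_add_lt hD (m - j) (by omega) (by omega) (fun a ha => ?_)
    (by rwa [Nat.add_sub_cancel' hj])
  have := tail_eq_iff.1 h a
  rwa [periodicExt_of_lt (by omega), periodicExt_of_lt (by omega)] at this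

theorem tail_lt_or_eq_of_rank_lt (hD : Distinct m P) (hC : Compat m P U) (hp : IsPred m P p)
    {i j : ℕ} (hi : i ≤ m) (hj : j ≤ m) (h : P i < P j) :
    tail (periodicExt p m U) i < tail (periodicExt p m U) j ∨
      (tail (periodicExt p m U) i = tail (periodicExt p m U) j ∧ i < j) := by
  have hle : tail (periodicExt p m U) i ≤ tail (periodicExt p m U) j := by
    rcases hi.lt_or_eq with hi | rfl
    · rcases hj.lt_or_eq with hj | rfl
      · apply tail_le_of_wrap_le hD hC hp
        rw [wrap_of_lt hi, wrap_of_lt hj]; exact h.le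
      · apply tail_le_of_wrap_le hD hC hp
        rw [wrap_of_lt hi, wrap_self hp.lt]; exact hp.rank_le i hi h
    · rcases hj.lt_or_eq with hj | rfl
      · apply tail_le_of_wrap_le hD hC hp
        rw [wrap_of_lt hj, wrap_self hp.lt]; exact (hp.rank_lt.trans h).le
      · exact le_rfl
  rcases hle.lt_or_eq with h' | h'
  · exact Or.inl h'
  · refine Or.inr ⟨h', ?_⟩
    rcases lt_trichotomy i j with h2 | rfl | h2
    · exact h2
    · exact absurd h (lt_irrefl _)
    · exact absurd h (not_lt.2 (rank_lt_of_tail_eq hD hC hp h2 hi h'.symm).le)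

/-- A compatible ranking is determined by the word and the position ranked just below `m`. -/
theorem rank_lt_iff (hD : Distinct m P) (hC : Compat m P U) (hp : IsPred m P p)
    {i j : ℕ} (hi : i ≤ m) (hj : j ≤ m) :
    P i < P j ↔ tail (periodicExt p m U) i < tail (periodicExt p m U) j ∨
      (tail (periodicExt p m U) i = tail (periodicExt p m U) j ∧ i < j) := by
  refine hD.lt_iff (R := fun i j => tail (periodicExt p m U) i < tail (periodicExt p m U) j ∨
      (tail (periodicExt p m U) i = tail (periodicExt p m U) j ∧ i < j)) ?_
    (fun i hi j hj => tail_lt_or_eq_of_rank_lt hD hC hp hi hj) hi hj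
  rintro i - j - (h | ⟨h, h'⟩) (h2 | ⟨h2, h2'⟩)
  · exact lt_asymm h h2
  · exact h.ne h2.symm
  · exact h2.ne h.symm
  · omega

/-- A repeated tail inside the loop would, by the left-to-right rule for ties, have rank strictly
between those of p and m. This is what makes the looped suffix primitive. -/
theorem tail_add_ne (hD : Distinct m P) (hC : Compat m P U) (hp : IsPred m P p)
    {d : ℕ} (hd : 0 < d) (hdm : p + d < m) :
    tail (periodicExt p m U) (p + d) ≠ tail (periodicExt p m U) p := by
  intro h
  have h1 := rank_lt_of_tail_eq hD hC hp (show p < p + d by omega) hdm.le h.symm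
  have h2 := rank_lt_of_tail_eq hD hC hp hdm le_rfl (h.trans (tail_periodicExt_self hp.lt).symm)
  exact absurd (hp.rank_le _ hdm h2) (not_le.2 h1)

end Core

/-! ### Primitive words and periods -/

section Primitive

variable {α : Type*}

theorem getElem?_flatten_replicate (u : List α) (k i : ℕ) (hi : i < k * u.length) :
    (List.replicate k u).flatten[i]? = u[i % u.length]? := by
  induction k generalizing i with
  | zero => simp at hi
  | succ k ih =>
    rw [List.replicate_succ, List.flatten_cons]
    by_cases h : i < u.length
    · rw [List.getElem?_append_left h, Nat.mod_eq_of_lt h]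
    · rw [List.getElem?_append_right (not_lt.1 h), ih, ← Nat.mod_eq_sub_mod (not_lt.1 h)]
      rw [Nat.succ_mul] at hi
      omega

/-- Euclid's algorithm on periods. A smaller period need not divide the word length, but its gcd
with that length does, and this exhibits a proper power. -/
theorem periodic_gcd {V : ℕ → α} (a b : ℕ) (ha : Function.Periodic V a)
    (hb : Function.Periodic V b) : Function.Periodic V (Nat.gcd a b) := by
  induction a, b using Nat.gcd.induction with
  | H0 b => simpa using hb
  | H1 a b _ ih =>
    rw [Nat.gcd_rec]
    refine ih (fun x => ?_) ha
    have h := hb x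
    rw [← Nat.mod_add_div b a, ← add_assoc, mul_comm] at h
    rw [← h]
    exact ((ha.nat_mul (b / a)) (x + b % a)).symm

/-- One period of a periodic sequence is a primitive word exactly when the sequence has no
smaller period. -/
theorem isPrimitive_ofFn_iff {V : ℕ → α} {t : ℕ} (ht : 0 < t) (hV : Function.Periodic V t) :
    IsPrimitive (List.ofFn fun i : Fin t => V i) ↔
      ∀ d, 0 < d → d < t → ¬ Function.Periodic V d := by
  constructor
  · intro h d hd hdt hper
    apply h
    have hg := periodic_gcd d t hper hV
    have hgd : Nat.gcd d t ≤ d := Nat.gcd_le_left t hd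
    have hgpos : 0 < Nat.gcd d t := Nat.gcd_pos_of_pos_left t hd
    obtain ⟨q, hq⟩ := Nat.gcd_dvd_right d t
    generalize Nat.gcd d t = g at *
    refine ⟨List.ofFn fun i : Fin g => V i, q, ?_, ?_⟩
    · by_contra hq1
      have : q = 0 ∨ q = 1 := by omega
      rcases this with rfl | rfl <;> omega
    · apply List.ext_getElem?
      intro i
      by_cases hi : i < t
      · rw [getElem?_flatten_replicate _ _ _ (by rw [List.length_ofFn, mul_comm, ← hq]; exact hi)]
        have h2 := Nat.mod_lt i hgpos
        simp [hi, h2, hg.map_mod_nat]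
      · rw [List.getElem?_eq_none (by simpa using hi), List.getElem?_eq_none]
        simp only [List.length_flatten, List.map_replicate, List.length_ofFn, List.sum_replicate,
          smul_eq_mul]
        rw [mul_comm, ← hq]; omega
  · rintro h ⟨u, k, hk, hu⟩
    have hlen : t = k * u.length := by
      have := congrArg List.length hu
      simpa using this
    have hupos : 0 < u.length := by
      by_contra h0
      rw [show u.length = 0 by omega] at hlen
      omega
    refine h u.length hupos (by rw [hlen]; nlinarith) ?_
    have hval : ∀ i, some (V i) = u[i % u.length]? := by
      intro i
      have hi : i % t < t := Nat.mod_lt i ht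
      have h1 := getElem?_flatten_replicate u k (i % t) (by rw [← hlen]; exact hi)
      rw [← hu, Nat.mod_mod_of_dvd _ (Dvd.intro_left k hlen.symm)] at h1
      rw [← h1]
      simp [hi, hV.map_mod_nat]
    intro i
    have h1 := hval (i + u.length)
    rw [Nat.add_mod_right, ← hval i] at h1
    exact Option.some.inj h1

end Primitive

/-! ### Permutations as rankings -/

/-- The ranking of positions given by a permutation. -/
def rank {n : ℕ} (π : Equiv.Perm (Fin (n + 1))) (i : ℕ) : ℕ := π (Fin.ofNat (n + 1) i)

/-- The letters of a finite word as natural numbers, with arbitrary values beyond its end. -/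
def letters {n M : ℕ} (U : Fin (n + 1) → Fin M) (i : ℕ) : ℕ := U (Fin.ofNat (n + 1) i)

section Rank

variable {n : ℕ}

theorem rank_val (π : Equiv.Perm (Fin (n + 1))) (i : Fin (n + 1)) : rank π i = π i := by
  simp [rank]

theorem rank_of_le (π : Equiv.Perm (Fin (n + 1))) {i : ℕ} (hi : i ≤ n) :
    rank π i = π ⟨i, by omega⟩ := rank_val π ⟨i, by omega⟩

theorem letters_val {M : ℕ} (U : Fin (n + 1) → Fin M) (i : Fin (n + 1)) :
    letters U i = U i := by
  simp [letters]

theorem letters_lt {M : ℕ} (U : Fin (n + 1) → Fin M) (i : ℕ) : letters U i < M := (U _).2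

theorem letters_of_lt {M : ℕ} (U : Fin (n + 1) → Fin M) {i : ℕ} (hi : i < n + 1) :
    letters U i = U ⟨i, hi⟩ := letters_val U ⟨i, hi⟩

theorem distinct_rank (π : Equiv.Perm (Fin (n + 1))) : Distinct n (rank π) := by
  intro i hi j hj h
  rw [rank_of_le π hi, rank_of_le π hj, Fin.val_inj, π.injective.eq_iff] at h
  simpa using h

theorem perm_ext_of_lt_iff {π ρ : Equiv.Perm (Fin n)} (h : ∀ i j, π i < π j ↔ ρ i < ρ j) :
    π = ρ := by
  have hm : StrictMono (π.symm.trans ρ) := by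
    intro a b hab
    rw [Equiv.trans_apply, Equiv.trans_apply, ← h]
    simpa using hab
  have h1 := (Equiv.Perm.monotone_iff _).1 hm.monotone
  ext1 i
  have h2 := congrArg (fun e : Equiv.Perm (Fin n) => e (π i)) h1
  simpa using h2.symm

theorem perm_ext_of_rank {π ρ : Equiv.Perm (Fin (n + 1))}
    (h : ∀ i ≤ n, ∀ j ≤ n, rank π i < rank π j ↔ rank ρ i < rank ρ j) : π = ρ := by
  refine perm_ext_of_lt_iff fun i j => ?_
  have := h i (by omega) j (by omega)
  simpa only [rank_val, Fin.val_fin_lt] using this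

theorem exists_perm_lt_iff {α : Type*} [LinearOrder α] (key : Fin n → α)
    (hk : Function.Injective key) : ∃ π : Equiv.Perm (Fin n), ∀ i j, π i < π j ↔ key i < key j := by
  refine ⟨(Tuple.sort key).symm, fun i j => ?_⟩
  have hm : StrictMono (key ∘ Tuple.sort key) :=
    (Tuple.monotone_sort key).strictMono_of_injective (hk.comp (Equiv.injective _))
  rw [← hm.lt_iff_lt]
  simp

/-- Ranking of the first `n + 1` tails of an infinite word, ties being broken from left to
right. -/
theorem exists_perm_tail (W : ℕ → ℕ) : ∃ π : Equiv.Perm (Fin (n + 1)), ∀ i ≤ n, ∀ j ≤ n,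
    rank π i < rank π j ↔ tail W i < tail W j ∨ (tail W i = tail W j ∧ i < j) := by
  obtain ⟨π, hπ⟩ := exists_perm_lt_iff (n := n + 1) (fun i => toLex (tail W i, i)) (by
    intro i j h
    simpa using congrArg (fun x => (ofLex x).2) h)
  refine ⟨π, fun i hi j hj => ?_⟩
  rw [rank_of_le π hi, rank_of_le π hj, Fin.val_fin_lt, hπ, Prod.Lex.toLex_lt_toLex]
  exact Iff.rfl

/-- Breaking ties from left to right is invariant under shifting both positions. -/
theorem compat_of_tail {m : ℕ} {P W : ℕ → ℕ}
    (h : ∀ i ≤ m, ∀ j ≤ m, P i < P j ↔ tail W i < tail W j ∨ (tail W i = tail W j ∧ i < j)) :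
    Compat m P W := by
  intro i hi j hj hij
  rcases (h i hi.le j hj.le).1 hij with h' | ⟨h', hlt⟩
  · rcases tail_lt_iff_step.1 h' with h2 | ⟨h2, h3⟩
    · exact Or.inl h2
    · exact Or.inr ⟨h2, (h _ (by omega) _ (by omega)).2 (Or.inl h3)⟩
  · obtain ⟨h2, h3⟩ := tail_eq_iff_step.1 h'
    exact Or.inr ⟨h2, (h _ (by omega) _ (by omega)).2 (Or.inr ⟨h3, by omega⟩)⟩

theorem exists_isPred (π : Equiv.Perm (Fin (n + 1))) (h : rank π n ≠ 0) :
    ∃ p, IsPred n (rank π) p := by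
  have hn := rank_of_le π (le_refl n)
  have hlt : rank π n < n + 1 := by rw [hn]; exact (π _).2
  let x : Fin (n + 1) := π.symm ⟨rank π n - 1, by omega⟩
  have hx : rank π x = rank π n - 1 := by rw [rank_val]; simp [x]
  have hxn : (x : ℕ) ≠ n := by
    intro h'
    rw [h'] at hx
    omega
  exact ⟨x, by omega, by omega, fun i _ hi => by omega⟩

theorem IsPred.unique {P : ℕ → ℕ} {p q : ℕ} (hD : Distinct n P) (hp : IsPred n P p)
    (hq : IsPred n P q) : p = q :=
  hD _ hp.lt.le _ hq.lt.le
    (le_antisymm (hq.rank_le _ hp.lt hp.rank_lt) (hp.rank_le _ hq.lt hq.rank_lt))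

end Rank

/-! ### Realized permutations and compatible words -/

section Realize

variable {m M : ℕ} {P U : ℕ → ℕ} {p : ℕ}

/-- After appending zeros, the tail at m is the zero word, and every earlier tail contains the
nonzero letter `U (m - 1)`. -/
theorem exists_realization_of_min (hC : Compat m P U) (hU : ∀ i, U i < M)
    (hmin : ∀ i < m, P m < P i) (hlast : U (m - 1) ≠ 0) :
    ∃ w : ℕ → ℕ, (∀ k, w k < M) ∧
      ∀ i ≤ m, ∀ j ≤ m, P i < P j → tail w i < tail w j := by
  have hM := (Nat.zero_le _).trans_lt (hU 0)
  set w : ℕ → ℕ := fun k => if k < m then U k else 0 with hw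
  have hw0 : ∀ k, w (m + k) = 0 := fun k => if_neg (by omega)
  refine ⟨w, fun k => ?_, ?_⟩
  · simp only [hw]
    split_ifs
    exacts [hU k, hM]
  · refine (hC.congr fun i hi => (if_pos hi).symm : Compat m P w).tail_lt
      (fun i hi h => absurd h (hmin i hi).not_gt) fun i hi _ => ?_
    refine not_le.1 fun hle => ?_
    revert hle
    rw [le_iff_lt_or_eq]
    rintro (h | h)
    · obtain ⟨k, -, h2⟩ := tail_lt_iff.1 h
      rw [hw0] at h2
      omega
    · have h2 := tail_eq_iff.1 h (m - 1 - i)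
      rw [hw0, show i + (m - 1 - i) = m - 1 by omega] at h2
      exact hlast ((if_pos (show m - 1 < m by omega)).symm.trans h2)

/-- The periodic extension does not end in copies of the largest letter. -/
theorem periodicExt_ne_top (hD : Distinct m P) (hC : Compat m P U) (hp : IsPred m P p)
    (hU : ∀ i, U i < M) (hmax : (∀ i < m, P i < P m) → U (m - 1) + 1 ≠ M) {i : ℕ} (hi : i < m) :
    ¬ ∀ k, periodicExt p m U (i + k) + 1 = M := by
  intro h
  have hpm := hp.lt
  have h' : ∀ k, periodicExt p m U (m - 1 + k) + 1 = M := by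
    intro k
    have := h (m - 1 - i + k)
    rwa [show i + (m - 1 - i + k) = m - 1 + k by omega] at this
  -- If p < m-1, then p and m-1 would be two loop positions with the same constant tail.
  have hpt : p = m - 1 := by
    by_contra hne
    refine tail_add_ne hD hC hp (d := m - 1 - p) (by omega) (by omega) ?_
    rw [← tail_periodicExt_self hp.lt, tail_eq_iff]
    intro k
    have h1 := h' k
    have h2 := h' (1 + k)
    rw [show m - 1 + (1 + k) = m + k by omega] at h2
    rw [show p + (m - 1 - p) + k = m - 1 + k by omega]
    omega
  have hlast : U (m - 1) + 1 = M := by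
    have := h' 0
    rwa [add_zero, periodicExt_of_lt (by omega)] at this
  refine hmax ?_ hlast
  -- Position p = m-1 carries the top letter. A position ranked above m must then carry it too, and
  -- its successor is again ranked above m; iterating reaches m itself.
  have key : ∀ d i, m - i = d → i < m → ¬ P m < P i := by
    intro d
    induction d with
    | zero => intro i hd hi; omega
    | succ d ih =>
      intro i hd hi hlt
      rcases hC p hp.lt i hi (hp.rank_lt.trans hlt) with h1 | ⟨-, h1⟩
      · have := hU i
        rw [hpt] at h1
        omega
      · rw [hpt, show m - 1 + 1 = m by omega] at h1
        rcases (show i + 1 ≤ m by omega).lt_or_eq with h2 | h2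
        · exact ih (i + 1) (by omega) h2 h1
        · rw [h2] at h1; exact lt_irrefl _ h1
  intro i hi
  exact (hD.lt_or_lt hi.le le_rfl hi.ne).resolve_right (key _ i rfl hi)

/-- The periodic extension is cut at a far index L and continued with M-1. Strict comparisons are
decided before L; in a tie i < j, the tail at j reaches the final block first and becomes the larger
one. -/
theorem exists_realization_of_isPred (hD : Distinct m P) (hC : Compat m P U) (hp : IsPred m P p)
    (hU : ∀ i, U i < M) (hmax : (∀ i < m, P i < P m) → U (m - 1) + 1 ≠ M) :
    ∃ w : ℕ → ℕ, (∀ k, w k < M) ∧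
      ∀ i ≤ m, ∀ j ≤ m, P i < P j → tail w i < tail w j := by
  have hM := (Nat.zero_le _).trans_lt (hU 0)
  set W := periodicExt p m U with hW
  have hWM : ∀ k, W k < M := fun k => hU _
  have hex : ∀ i j, ∃ k, tail W i < tail W j →
      (∀ l < k, W (i + l) = W (j + l)) ∧ W (i + k) < W (j + k) := by
    intro i j
    by_cases h : tail W i < tail W j
    · obtain ⟨k, hk⟩ := tail_lt_iff.1 h
      exact ⟨k, fun _ => hk⟩
    · exact ⟨0, fun h' => absurd h' h⟩
  choose κ hκ using hex
  set L := 2 * m + 1 +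
    (Finset.range (m + 1) ×ˢ Finset.range (m + 1)).sup (fun x => κ x.1 x.2) with hL
  have hLκ : ∀ i ≤ m, ∀ j ≤ m, 2 * m + κ i j < L := by
    intro i hi j hj
    have : κ i j ≤ (Finset.range (m + 1) ×ˢ Finset.range (m + 1)).sup (fun x => κ x.1 x.2) :=
      Finset.le_sup (f := fun x : ℕ × ℕ => κ x.1 x.2) (b := (i, j))
        (by simp only [Finset.mem_product, Finset.mem_range]; omega)
    omega
  set w : ℕ → ℕ := fun k => if k < L then W k else M - 1 with hw
  have hwl : ∀ k < L, w k = W k := fun k hk => if_pos hk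
  have hwr : ∀ k, L ≤ k → w k = M - 1 := fun k hk => if_neg (not_lt.2 hk)
  have hwM : ∀ k, w k < M := by
    intro k
    rcases lt_or_ge k L with h | h
    · rw [hwl k h]; exact hWM k
    · rw [hwr k h]; omega
  refine ⟨w, hwM, fun i hi j hj hij => ?_⟩
  have hLij := hLκ i hi j hj
  rcases tail_lt_or_eq_of_rank_lt hD hC hp hi hj hij with h | ⟨h, hlt⟩
  · obtain ⟨h1, h2⟩ := hκ i j h
    refine tail_lt_iff.2 ⟨κ i j, fun l hl => ?_, ?_⟩
    · rw [hwl _ (by omega), hwl _ (by omega)]; exact h1 l hl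
    · rw [hwl _ (by omega), hwl _ (by omega)]; exact h2
  · refine not_le.1 fun hle => ?_
    revert hle
    rw [le_iff_lt_or_eq]
    have hWe : ∀ k, W (i + k) = W (j + k) := tail_eq_iff.1 h
    rintro (h' | h')
    · obtain ⟨k, -, h2⟩ := tail_lt_iff.1 h'
      rcases lt_or_ge (j + k) L with h3 | h3
      · rw [hwl _ h3, hwl _ (by omega)] at h2
        exact h2.ne (hWe k).symm
      · rw [hwr _ h3] at h2
        have := hwM (i + k)
        omega
    · have hwe := tail_eq_iff.1 h'
      obtain ⟨d, hd0, rfl⟩ : ∃ d, 0 < d ∧ j = i + d := ⟨j - i, by omega, by omega⟩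
      have hper : Function.Periodic (fun k => w (i + k)) d := by
        intro k
        change w (i + (k + d)) = w (i + k)
        rw [← hwe k, show i + (k + d) = i + d + k by omega]
      have hperW : Function.Periodic (fun k => W (i + k)) d := by
        intro k
        change W (i + (k + d)) = W (i + k)
        rw [hWe k, show i + (k + d) = i + d + k by omega]
      -- If the tails of w still agreed, w would be d-periodic from i on and eventually M-1, making
      -- the periodic extension constantly M-1 from i on.
      refine periodicExt_ne_top hD hC hp hU hmax (i := i) (by omega) fun k => ?_
      have h1 : W (i + k) = W (i + k % d) := (hperW.map_mod_nat k).symm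
      have h2 : w (i + k % d) = w (i + (k % d + L * d)) := ((hper.nat_mul L) (k % d)).symm
      have h3 := Nat.mod_lt k hd0
      have h4 : L ≤ L * d := Nat.le_mul_of_pos_right L hd0
      rw [hwl (i + k % d) (by omega), hwr (i + (k % d + L * d)) (by omega)] at h2
      rw [← hW, h1, h2]
      omega

end Realize

/-- The words `U` of length `k + 1` that begin an infinite word over `M` letters realizing `π`. -/
def Admissible {k M : ℕ} (π : Equiv.Perm (Fin (k + 2))) (U : Fin (k + 1) → Fin M) : Prop :=
  Compat (k + 1) (rank π) (letters U) ∧ (rank π (k + 1) = 0 → letters U k ≠ 0) ∧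
    (rank π (k + 1) = k + 1 → letters U k + 1 ≠ M)

section Pattern

variable {k M : ℕ}

theorem shift_iterate (w : Word M) (i l : ℕ) :
    ofLex ((shift M)^[i] w) l = ofLex w (i + l) := by
  induction i generalizing l with
  | zero => simp
  | succ i ih =>
    rw [Function.iterate_succ_apply']
    change ofLex ((shift M)^[i] w) (l + 1) = _
    rw [ih, show i + (l + 1) = i + 1 + l by omega]

theorem shift_iterate_lt_iff (w : Word M) (i j : ℕ) :
    (shift M)^[i] w < (shift M)^[j] w ↔
      tail (fun l => (ofLex w l : ℕ)) i < tail (fun l => (ofLex w l : ℕ)) j := by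
  change (∃ l, (∀ a < l, ofLex ((shift M)^[i] w) a = ofLex ((shift M)^[j] w) a) ∧
    ofLex ((shift M)^[i] w) l < ofLex ((shift M)^[j] w) l) ↔ _
  simp only [shift_iterate, tail_lt_iff, Fin.val_inj, Fin.val_fin_lt]

theorem hasPattern_iff {n : ℕ} (w : Word M) (π : Equiv.Perm (Fin (n + 1))) :
    HasPattern (shift M) w π ↔ ∀ i ≤ n, ∀ j ≤ n, rank π i < rank π j ↔
      tail (fun l => (ofLex w l : ℕ)) i < tail (fun l => (ofLex w l : ℕ)) j := by
  constructor
  · intro h i hi j hj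
    rw [← shift_iterate_lt_iff, rank_of_le π hi, rank_of_le π hj, Fin.val_fin_lt]
    exact (h ⟨i, by omega⟩ ⟨j, by omega⟩).symm
  · intro h i j
    refine (shift_iterate_lt_iff w i j).trans ?_
    rw [← h i (by omega) j (by omega), rank_val, rank_val, Fin.val_fin_lt]

theorem rank_lt_succ {n : ℕ} (π : Equiv.Perm (Fin (n + 1))) (i : ℕ) : rank π i < n + 1 := (π _).2

theorem exists_rank_eq {n : ℕ} (π : Equiv.Perm (Fin (n + 1))) {r : ℕ} (hr : r ≤ n) :
    ∃ i ≤ n, rank π i = r :=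
  ⟨π.symm ⟨r, by omega⟩, by omega, by rw [rank_val]; simp⟩

theorem rank_last_eq_zero_iff {n : ℕ} (π : Equiv.Perm (Fin (n + 1))) :
    rank π n = 0 ↔ ∀ i < n, rank π n < rank π i := by
  constructor
  · intro h i hi
    rcases distinct_rank π |>.lt_or_lt hi.le le_rfl hi.ne with h' | h'
    · omega
    · exact h'
  · intro h
    obtain ⟨i, hi, h0⟩ := exists_rank_eq π (Nat.zero_le n)
    rcases hi.lt_or_eq with hi | rfl
    · have := h i hi; omega
    · exact h0

theorem rank_last_eq_last_iff {n : ℕ} (π : Equiv.Perm (Fin (n + 1))) :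
    rank π n = n ↔ ∀ i < n, rank π i < rank π n := by
  constructor
  · intro h i hi
    rcases distinct_rank π |>.lt_or_lt hi.le le_rfl hi.ne with h' | h'
    · exact h'
    · have := rank_lt_succ π i
      omega
  · intro h
    obtain ⟨i, hi, h0⟩ := exists_rank_eq π (le_refl n)
    rcases hi.lt_or_eq with hi | rfl
    · have := h i hi
      have := rank_lt_succ π n
      omega
    · exact h0

/-- The end conditions are necessary: a tail that decreases under the shift is followed by a letter
below its first one, impossible if that is 0, and dually for M-1. -/
theorem mem_allowedPatterns_iff (π : Equiv.Perm (Fin (k + 2))) :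
    π ∈ allowedPatterns (shift M) (k + 2) ↔ ∃ U : Fin (k + 1) → Fin M, Admissible π U := by
  constructor
  · rintro ⟨w, hw⟩
    rw [hasPattern_iff] at hw
    set W : ℕ → ℕ := fun l => (ofLex w l : ℕ) with hW
    have hU : ∀ i < k + 1, W i = letters (fun i : Fin (k + 1) => ofLex w i) i := by
      intro i hi
      rw [letters_of_lt _ hi]
    refine ⟨fun i => ofLex w i, Compat.congr (U := W) ?_ hU, ?_, ?_⟩
    · intro i hi j hj h
      rw [hw _ hi.le _ hj.le, tail_lt_iff_step] at h
      rwa [hw _ (by omega) _ (by omega)]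
    · intro h h0
      rw [rank_last_eq_zero_iff] at h
      obtain ⟨l, hl⟩ := exists_lt_of_tail_succ_lt
        ((hw (k + 1) le_rfl k (by omega)).1 (h k (by omega)))
      rw [hU k (by omega), h0] at hl
      omega
    · intro h h0
      rw [rank_last_eq_last_iff] at h
      obtain ⟨l, hl⟩ := exists_gt_of_lt_tail_succ
        ((hw k (by omega) (k + 1) le_rfl).1 (h k (by omega)))
      rw [hU k (by omega)] at hl
      have : W l < M := (ofLex w l).2
      omega
  · rintro ⟨U, hC, hlo, hhi⟩
    have hD := distinct_rank π
    obtain ⟨w, hwM, hw⟩ : ∃ w : ℕ → ℕ, (∀ k, w k < M) ∧ ∀ i ≤ k + 1, ∀ j ≤ k + 1,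
        rank π i < rank π j → tail w i < tail w j := by
      by_cases h0 : rank π (k + 1) = 0
      · exact exists_realization_of_min hC (letters_lt U) ((rank_last_eq_zero_iff π).1 h0) (hlo h0)
      · obtain ⟨p, hp⟩ := exists_isPred π h0
        exact exists_realization_of_isPred hD hC hp (letters_lt U)
          fun h => hhi ((rank_last_eq_last_iff π).2 h)
    refine ⟨toLex fun l => ⟨w l, hwM l⟩, (hasPattern_iff _ π).2 fun i hi j hj => ?_⟩
    exact hD.lt_iff (R := fun i j => tail w i < tail w j) (fun _ _ _ _ h => h.not_gt) hw hi hj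

end Pattern

/-! ### The number of permutations compatible with a given word -/

section CountPerms

variable {n : ℕ}

/-- The letter at n is a sentinel settling every comparison with n at once; compatibility then
forces all the others. -/
theorem existsUnique_compat_min {W : ℕ → ℕ} (hW : ∀ i < n, W n < W i) :
    ∃! π : Equiv.Perm (Fin (n + 1)), Compat n (rank π) W ∧ rank π n = 0 := by
  obtain ⟨π, hπ⟩ := exists_perm_tail (n := n) W
  have hlt : ∀ i < n, tail W n < tail W i := fun i hi => tail_lt_iff_step.2 (Or.inl (hW i hi))
  refine ⟨π, ⟨compat_of_tail hπ, ?_⟩, ?_⟩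
  · rw [rank_last_eq_zero_iff]
    exact fun i hi => (hπ n le_rfl i hi.le).2 (Or.inl (hlt i hi))
  · rintro ρ ⟨hC, h0⟩
    rw [rank_last_eq_zero_iff] at h0
    have h1 := hC.tail_lt (fun i hi h => absurd h (h0 i hi).not_gt) fun i hi _ => hlt i hi
    refine (perm_ext_of_rank fun i hi j hj => ?_).symm
    by_contra hne
    have hij : i ≠ j := by rintro rfl; simp at hne
    have := (distinct_rank ρ).lt_or_lt hi hj hij
    rcases this with h | h
    · exact hne ⟨fun _ => h, fun _ => (hπ i hi j hj).2 (Or.inl (h1 i hi j hj h))⟩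
    · refine hne ⟨fun h' => absurd h' ?_, fun h' => absurd h' h.not_gt⟩
      exact ((hπ j hj i hi).2 (Or.inl (h1 j hj i hi h))).not_gt

theorem existsUnique_compat_max {W : ℕ → ℕ} (hW : ∀ i < n, W i < W n) :
    ∃! π : Equiv.Perm (Fin (n + 1)), Compat n (rank π) W ∧ rank π n = n := by
  obtain ⟨π, hπ⟩ := exists_perm_tail (n := n) W
  have hlt : ∀ i < n, tail W i < tail W n := fun i hi => tail_lt_iff_step.2 (Or.inl (hW i hi))
  refine ⟨π, ⟨compat_of_tail hπ, ?_⟩, ?_⟩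
  · rw [rank_last_eq_last_iff]
    exact fun i hi => (hπ i hi.le n le_rfl).2 (Or.inl (hlt i hi))
  · rintro ρ ⟨hC, h0⟩
    rw [rank_last_eq_last_iff] at h0
    have h1 := hC.tail_lt (fun i hi _ => hlt i hi) fun i hi h => absurd h (h0 i hi).not_gt
    refine (perm_ext_of_rank fun i hi j hj => ?_).symm
    by_contra hne
    have hij : i ≠ j := by rintro rfl; simp at hne
    have := (distinct_rank ρ).lt_or_lt hi hj hij
    rcases this with h | h
    · exact hne ⟨fun _ => h, fun _ => (hπ i hi j hj).2 (Or.inl (h1 i hi j hj h))⟩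
    · refine hne ⟨fun h' => absurd h' ?_, fun h' => absurd h' h.not_gt⟩
      exact ((hπ j hj i hi).2 (Or.inl (h1 j hj i hi h))).not_gt

theorem compat_iff_of_lt_iff {m : ℕ} {P U W : ℕ → ℕ}
    (h : ∀ i < m, ∀ j < m, U i < U j ↔ W i < W j) : Compat m P U ↔ Compat m P W := by
  have he : ∀ i < m, ∀ j < m, U i = U j ↔ W i = W j := by
    intro i hi j hj
    have h1 := h i hi j hj
    have h2 := h j hj i hi
    omega
  constructor
  · intro hC i hi j hj hij
    rw [← h i hi j hj, ← he i hi j hj]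
    exact hC i hi j hj hij
  · intro hC i hi j hj hij
    rw [h i hi j hj, he i hi j hj]
    exact hC i hi j hj hij

theorem existsUnique_compat_letters_min (U : ℕ → ℕ) :
    ∃! π : Equiv.Perm (Fin (n + 1)), Compat n (rank π) U ∧ rank π n = 0 := by
  -- Raising all letters by one makes room for the sentinel 0 without changing their order.
  have h := existsUnique_compat_min (n := n) (W := fun i => if i < n then U i + 1 else 0)
    (fun i hi => by simp [hi])
  convert h using 3
  refine compat_iff_of_lt_iff fun i hi j hj => ?_
  simp [hi, hj]

theorem existsUnique_compat_letters_max {M : ℕ} (U : ℕ → ℕ) (hU : ∀ i, U i < M) :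
    ∃! π : Equiv.Perm (Fin (n + 1)), Compat n (rank π) U ∧ rank π n = n := by
  have h := existsUnique_compat_max (n := n) (W := fun i => if i < n then U i else M)
    (fun i hi => by simp [hi, hU])
  convert h using 3
  refine compat_iff_of_lt_iff fun i hi j hj => ?_
  simp [hi, hj]

end CountPerms

section CountCompat

variable {k M : ℕ}

/-- The suffix of length `t` of `U` is a primitive word. -/
def PrimitiveSuffix (U : Fin (k + 1) → Fin M) (t : ℕ) : Prop :=
  IsPrimitive (List.ofFn fun i : Fin t => U (Fin.ofNat (k + 1) (k + 1 - t + i)))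

theorem primitiveSuffix_iff (U : Fin (k + 1) → Fin M) {p : ℕ} (hp : p < k + 1) :
    PrimitiveSuffix U (k + 1 - p) ↔ ∀ d, 0 < d → p + d < k + 1 →
      tail (periodicExt p (k + 1) (letters U)) (p + d) ≠
        tail (periodicExt p (k + 1) (letters U)) p := by
  set V : ℕ → Fin M := fun i => U (Fin.ofNat (k + 1) (wrap p (k + 1) (p + i))) with hV
  have hper : Function.Periodic V (k + 1 - p) := by
    intro i
    simp only [hV, wrap_add hp, Nat.add_mod_right]
  have hV' : (fun i : Fin (k + 1 - p) => U (Fin.ofNat (k + 1) (k + 1 - (k + 1 - p) + i))) =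
      fun i : Fin (k + 1 - p) => V i := by
    funext i
    have := i.2
    simp only [hV]
    rw [wrap_of_lt (by omega), show k + 1 - (k + 1 - p) = p by omega]
  rw [PrimitiveSuffix, hV', isPrimitive_ofFn_iff (by omega) hper]
  refine forall_congr' fun d => forall_congr' fun _ => ?_
  rw [show d < k + 1 - p ↔ p + d < k + 1 by omega]
  refine forall_congr' fun _ => not_congr ?_
  rw [tail_eq_iff]
  refine forall_congr' fun i => ?_
  rw [← Fin.val_inj, add_comm i d]
  simp only [hV, periodicExt, letters, add_assoc]

/-- A position ranked strictly between p and m would share their tail and lie to the right of p,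
giving the loop a shorter period. -/
theorem isPred_of_primitiveSuffix (U : Fin (k + 1) → Fin M) {p : ℕ} (hp : p < k + 1)
    (h : PrimitiveSuffix U (k + 1 - p)) {P : ℕ → ℕ}
    (hP : ∀ i ≤ k + 1, ∀ j ≤ k + 1, P i < P j ↔
      tail (periodicExt p (k + 1) (letters U)) i < tail (periodicExt p (k + 1) (letters U)) j ∨
      (tail (periodicExt p (k + 1) (letters U)) i = tail (periodicExt p (k + 1) (letters U)) j ∧
        i < j)) : IsPred (k + 1) P p := by
  rw [primitiveSuffix_iff U hp] at h
  have hs := tail_periodicExt_self (U := letters U) hp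
  refine ⟨hp, (hP _ hp.le _ le_rfl).2 (Or.inr ⟨hs.symm, hp⟩), fun i hi hlt => ?_⟩
  by_contra hpi
  rcases (hP _ hi.le _ le_rfl).1 hlt with h1 | ⟨h1, -⟩
  · rw [hs] at h1
    exact absurd ((hP _ hi.le _ hp.le).2 (Or.inl h1)) (not_lt.2 (not_le.1 hpi).le)
  · rw [hs] at h1
    rcases lt_trichotomy i p with h2 | rfl | h2
    · exact absurd ((hP _ hi.le _ hp.le).2 (Or.inr ⟨h1, h2⟩)) (not_lt.2 (not_le.1 hpi).le)
    · exact hpi le_rfl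
    · refine h (i - p) (by omega) (by omega) ?_
      rwa [Nat.add_sub_cancel' h2.le]

-- The bijection sends a permutation to the loop length k+1-p, with 0 coding last rank 0.
open scoped Classical in
theorem card_compat (U : Fin (k + 1) → Fin M) :
    (Finset.univ.filter fun π : Equiv.Perm (Fin (k + 2)) =>
      Compat (k + 1) (rank π) (letters U)).card =
    1 + ((Finset.Icc 1 (k + 1)).filter fun t => PrimitiveSuffix U t).card := by
  have h0 : (0 : ℕ) ∉ (Finset.Icc 1 (k + 1)).filter fun t => PrimitiveSuffix U t := by simp
  rw [Nat.add_comm 1, ← Finset.card_insert_of_notMem h0]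
  have hex : ∀ π : Equiv.Perm (Fin (k + 2)), ∃ t, (rank π (k + 1) = 0 ∧ t = 0) ∨
      (rank π (k + 1) ≠ 0 ∧ 1 ≤ t ∧ t ≤ k + 1 ∧ IsPred (k + 1) (rank π) (k + 1 - t)) := by
    intro π
    by_cases h : rank π (k + 1) = 0
    · exact ⟨0, Or.inl ⟨h, rfl⟩⟩
    · obtain ⟨p, hp⟩ := exists_isPred π h
      have := hp.lt
      exact ⟨k + 1 - p, Or.inr ⟨h, by omega, by omega,
        by rwa [show k + 1 - (k + 1 - p) = p by omega]⟩⟩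
  choose τ hτ using hex
  refine Finset.card_bij (fun π _ => τ π) ?_ ?_ ?_
  · intro π hπ
    have hC : Compat (k + 1) (rank π) (letters U) := (Finset.mem_filter.1 hπ).2
    rw [Finset.mem_insert, Finset.mem_filter, Finset.mem_Icc]
    rcases hτ π with ⟨-, h⟩ | ⟨-, h1, h2, hp⟩
    · exact Or.inl h
    · refine Or.inr ⟨⟨h1, h2⟩, ?_⟩
      have := (primitiveSuffix_iff U hp.lt).2
        fun d => tail_add_ne (distinct_rank π) hC hp (d := d)
      rwa [show k + 1 - (k + 1 - τ π) = τ π by omega] at this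
  · intro π hπ ρ hρ he
    have hC : Compat (k + 1) (rank π) (letters U) := (Finset.mem_filter.1 hπ).2
    have hC' : Compat (k + 1) (rank ρ) (letters U) := (Finset.mem_filter.1 hρ).2
    rcases hτ π with ⟨h, h'⟩ | ⟨-, h1, h2, hp⟩
    · rcases hτ ρ with ⟨g, -⟩ | ⟨-, h3, -, -⟩
      · exact (existsUnique_compat_letters_min (letters U)).unique ⟨hC, h⟩ ⟨hC', g⟩
      · omega
    · rcases hτ ρ with ⟨-, h3⟩ | ⟨-, -, -, hp'⟩
      · omega
      · rw [← he] at hp'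
        refine perm_ext_of_rank fun i hi j hj => ?_
        rw [rank_lt_iff (distinct_rank π) hC hp hi hj, rank_lt_iff (distinct_rank ρ) hC' hp' hi hj]
  · intro t ht
    rw [Finset.mem_insert, Finset.mem_filter, Finset.mem_Icc] at ht
    rcases ht with rfl | ⟨⟨h1, h2⟩, ht⟩
    · obtain ⟨π, ⟨hC, h⟩, -⟩ := existsUnique_compat_letters_min (n := k + 1) (letters U)
      refine ⟨π, Finset.mem_filter.2 ⟨Finset.mem_univ _, hC⟩, ?_⟩
      rcases hτ π with ⟨-, h'⟩ | ⟨h', -⟩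
      · exact h'
      · exact absurd h h'
    · obtain ⟨π, hπ⟩ := exists_perm_tail (n := k + 1)
        (periodicExt (k + 1 - t) (k + 1) (letters U))
      have hp := isPred_of_primitiveSuffix U (p := k + 1 - t) (by omega)
        (by rwa [show k + 1 - (k + 1 - t) = t by omega]) hπ
      refine ⟨π, Finset.mem_filter.2 ⟨Finset.mem_univ _,
        (compat_of_tail hπ).congr fun i hi => periodicExt_of_lt hi⟩, ?_⟩
      rcases hτ π with ⟨h', -⟩ | ⟨-, h3, h4, hp'⟩
      · have := hp.rank_lt
        omega
      · have := hp.unique (distinct_rank π) hp'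
        omega

-- The compatible permutations that fail to be admissible are the one with last rank 0 when `U` ends
-- in 0, and the one with top last rank when `U` ends in M-1.
open scoped Classical in
theorem card_admissible (U : Fin (k + 1) → Fin M) :
    (Finset.univ.filter fun π : Equiv.Perm (Fin (k + 2)) => Admissible π U).card +
      (if letters U k = 0 then 1 else 0) + (if letters U k + 1 = M then 1 else 0) =
    1 + ((Finset.Icc 1 (k + 1)).filter fun t => PrimitiveSuffix U t).card := by
  rw [← card_compat]
  obtain ⟨α, ⟨hαC, hα⟩, hαu⟩ := existsUnique_compat_letters_min (n := k + 1) (letters U)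
  obtain ⟨β, ⟨hβC, hβ⟩, hβu⟩ :=
    existsUnique_compat_letters_max (n := k + 1) (letters U) (letters_lt U)
  have hne : α ≠ β := by
    rintro rfl
    omega
  have hdis : (Finset.univ.filter fun π : Equiv.Perm (Fin (k + 2)) =>
      Compat (k + 1) (rank π) (letters U)) =
      (Finset.univ.filter fun π : Equiv.Perm (Fin (k + 2)) => Admissible π U) ∪
        ((if letters U k = 0 then {α} else ∅) ∪ (if letters U k + 1 = M then {β} else ∅)) := by
    ext π
    have hmin : Compat (k + 1) (rank π) (letters U) → rank π (k + 1) = 0 → π = α :=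
      fun h h' => hαu π ⟨h, h'⟩
    have hmax : Compat (k + 1) (rank π) (letters U) → rank π (k + 1) = k + 1 → π = β :=
      fun h h' => hβu π ⟨h, h'⟩
    simp only [Finset.mem_filter, Finset.mem_univ, true_and, Finset.mem_union]
    constructor
    · intro hC
      by_cases h1 : rank π (k + 1) = 0 ∧ letters U k = 0
      · exact Or.inr (Or.inl (by rw [if_pos h1.2, Finset.mem_singleton]; exact hmin hC h1.1))
      by_cases h2 : rank π (k + 1) = k + 1 ∧ letters U k + 1 = M
      · exact Or.inr (Or.inr (by rw [if_pos h2.2, Finset.mem_singleton]; exact hmax hC h2.1))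
      exact Or.inl ⟨hC, fun h h' => h1 ⟨h, h'⟩, fun h h' => h2 ⟨h, h'⟩⟩
    · rintro (h | h | h)
      · exact h.1
      · split_ifs at h
        · rw [Finset.mem_singleton] at h; rwa [h]
        · simp at h
      · split_ifs at h
        · rw [Finset.mem_singleton] at h; rwa [h]
        · simp at h
  rw [hdis, Finset.card_union_of_disjoint, Finset.card_union_of_disjoint, add_assoc]
  · congr 2 <;> split_ifs <;> simp
  · split_ifs <;> simp [hne]
  · rw [Finset.disjoint_union_right]
    constructor
    · split_ifs with h
      · simp only [Finset.disjoint_singleton_right, Finset.mem_filter, Finset.mem_univ, true_and]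
        exact fun ha => ha.2.1 hα h
      · simp
    · split_ifs with h
      · simp only [Finset.disjoint_singleton_right, Finset.mem_filter, Finset.mem_univ, true_and]
        exact fun ha => ha.2.2 hβ h
      · simp

end CountCompat

/-! ### Summation over all words -/

section CountWords

variable {k M : ℕ}

open scoped Classical in
theorem card_words_last (a : Fin M) :
    (Finset.univ.filter fun U : Fin (k + 1) → Fin M => U (Fin.last k) = a).card = M ^ k := by
  have h : (Finset.univ.filter fun U : Fin (k + 1) → Fin M => U (Fin.last k) = a) =
      Fintype.piFinset (fun i : Fin (k + 1) => if i = Fin.last k then {a} else Finset.univ) := by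
    ext U
    simp only [Finset.mem_filter, Finset.mem_univ, true_and, Fintype.mem_piFinset]
    constructor
    · intro h i
      split_ifs with hi
      · rw [hi, h]; exact Finset.mem_singleton_self a
      · exact Finset.mem_univ _
    · intro h
      simpa using h (Fin.last k)
  rw [h, Fintype.card_piFinset, Fin.prod_univ_castSucc]
  simp [Fin.castSucc_ne_last]

theorem card_primitive_suffix (a t m : ℕ) (h : m = a + t) :
    Nat.card {U : Fin m → Fin M //
      IsPrimitive (List.ofFn fun i : Fin t => U (Fin.cast h.symm (Fin.natAdd a i)))} =
    numPrimitive M t * M ^ a := by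
  subst h
  have e : {U : Fin (a + t) → Fin M //
      IsPrimitive (List.ofFn fun i : Fin t => U (Fin.natAdd a i))} ≃
      (Fin a → Fin M) × {w : Fin t → Fin M // IsPrimitive (List.ofFn w)} :=
    { toFun := fun U => (fun i => U.1 (Fin.castAdd t i), ⟨fun i => U.1 (Fin.natAdd a i), U.2⟩)
      invFun := fun x => ⟨Fin.append x.1 x.2.1, by simpa using x.2.2⟩
      left_inv := fun U => by
        apply Subtype.ext
        exact Fin.append_castAdd_natAdd
      right_inv := fun x => by simp }
  simp only [Fin.cast_refl, id]
  rw [Nat.card_congr e, Nat.card_prod, numPrimitive, mul_comm]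
  simp

open scoped Classical in
theorem card_primitiveSuffix {t : ℕ} (ht : t ≤ k + 1) :
    (Finset.univ.filter fun U : Fin (k + 1) → Fin M => PrimitiveSuffix U t).card =
      numPrimitive M t * M ^ (k + 1 - t) := by
  rw [← card_primitive_suffix (k + 1 - t) t (k + 1) (by omega), Nat.card_eq_fintype_card,
    Fintype.card_subtype]
  congr 1
  ext U
  simp only [Finset.mem_filter, Finset.mem_univ, true_and]
  have : (fun i : Fin t => U (Fin.ofNat (k + 1) (k + 1 - t + i))) = fun i : Fin t =>
      U (Fin.cast (show k + 1 - t + t = k + 1 by omega) (Fin.natAdd (k + 1 - t) i)) := by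
    funext i
    congr 1
    apply Fin.ext
    have := i.2
    simp only [Fin.ofNat, Fin.val_cast, Fin.val_natAdd]
    exact Nat.mod_eq_of_lt (by omega)
  rw [PrimitiveSuffix, this]

open scoped Classical in
/-- The number of pairs of a permutation and an admissible word for it. -/
theorem sum_card_admissible (hM : 1 ≤ M) :
    (∑ U : Fin (k + 1) → Fin M,
      (Finset.univ.filter fun π : Equiv.Perm (Fin (k + 2)) => Admissible π U).card) +
      M ^ k + M ^ k = M ^ (k + 1) +
        ∑ t ∈ Finset.Icc 1 (k + 1), numPrimitive M t * M ^ (k + 1 - t) := by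
  have hlast : ∀ U : Fin (k + 1) → Fin M, letters U k = U (Fin.last k) := by
    intro U
    rw [letters_of_lt U (by omega)]
    rfl
  have h0 : (∑ U : Fin (k + 1) → Fin M, if letters U k = 0 then 1 else 0) = M ^ k := by
    rw [← card_words_last (k := k) (⟨0, by omega⟩ : Fin M), Finset.card_filter]
    refine Finset.sum_congr rfl fun U _ => ?_
    refine if_congr ?_ rfl rfl
    rw [hlast, Fin.ext_iff]
  have h1 : (∑ U : Fin (k + 1) → Fin M, if letters U k + 1 = M then 1 else 0) = M ^ k := by
    rw [← card_words_last (k := k) (⟨M - 1, by omega⟩ : Fin M), Finset.card_filter]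
    refine Finset.sum_congr rfl fun U _ => ?_
    refine if_congr ?_ rfl rfl
    rw [hlast, Fin.ext_iff]
    simp only
    omega
  have h2 : ∑ t ∈ Finset.Icc 1 (k + 1), numPrimitive M t * M ^ (k + 1 - t) =
      ∑ U : Fin (k + 1) → Fin M,
        ((Finset.Icc 1 (k + 1)).filter fun t => PrimitiveSuffix U t).card := by
    simp only [Finset.card_filter]
    rw [Finset.sum_comm]
    refine Finset.sum_congr rfl fun t ht => ?_
    rw [← card_primitiveSuffix (Finset.mem_Icc.1 ht).2, Finset.card_filter]
  have h3 : M ^ (k + 1) = ∑ _U : Fin (k + 1) → Fin M, 1 := by simp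
  nth_rw 1 [← h0]
  rw [← h1, h2, h3, ← Finset.sum_add_distrib, ← Finset.sum_add_distrib, ← Finset.sum_add_distrib]
  exact Finset.sum_congr rfl fun U _ => card_admissible U

end CountWords

/-! ### The number of words admissible for a given permutation -/

section Gaps

variable {k M : ℕ}

/-- The increments of `v`, including those from `0` to the first value and from the last value
to `M - 1`, are bounded below by `r 0, …, r (k + 1)`. -/
def Gap (r : ℕ → ℕ) (v : Fin (k + 1) → Fin M) : Prop :=
  r 0 ≤ v 0 ∧ (∀ j : Fin k, v j.castSucc + r (j + 1) ≤ v j.succ) ∧ v (Fin.last k) + r (k + 1) < M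

theorem Gap.sum_le {r : ℕ → ℕ} {v : Fin (k + 1) → Fin M} (h : Gap r v) (j : Fin (k + 1)) :
    ∑ i ∈ Finset.range (j + 1), r i ≤ v j := by
  induction j using Fin.induction with
  | zero => simpa using h.1
  | succ j ih =>
    rw [Finset.sum_range_succ]
    have h1 := h.2.1 j
    simp only [Fin.val_castSucc, Fin.val_succ] at ih ⊢
    omega

theorem Gap.strictMono {r : ℕ → ℕ} {v : Fin (k + 1) → Fin M} (h : Gap r v) :
    StrictMono fun j : Fin (k + 1) => (v j : ℕ) - ∑ i ∈ Finset.range (j + 1), r i + j := by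
  rw [Fin.strictMono_iff_lt_succ]
  intro j
  have h1 := h.2.1 j
  have h2 := h.sum_le j.castSucc
  have h3 := h.sum_le j.succ
  simp only [Fin.val_castSucc, Fin.val_succ] at h2 h3 ⊢
  rw [Finset.sum_range_succ _ (j + 1 : ℕ)] at h3 ⊢
  omega

-- Stars and bars: removing the forced increments and adding j identifies these sequences with
-- (k+1)-subsets of an interval.
open scoped Classical in
theorem card_gap (r : ℕ → ℕ) :
    (Finset.univ.filter fun v : Fin (k + 1) → Fin M => Gap r v).card =
      if ∑ i ∈ Finset.range (k + 2), r i < M then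
        (M - 1 - (∑ i ∈ Finset.range (k + 2), r i) + (k + 1)).choose (k + 1) else 0 := by
  set c := ∑ i ∈ Finset.range (k + 2), r i with hc
  have hcs : c = (∑ i ∈ Finset.range (k + 1), r i) + r (k + 1) := Finset.sum_range_succ _ _
  split_ifs with hcM
  · rw [← Finset.card_range (M - 1 - c + (k + 1)), ← Finset.card_powersetCard]
    refine Finset.card_bij (fun v _ => Finset.univ.image
      fun j : Fin (k + 1) => (v j : ℕ) - ∑ i ∈ Finset.range (j + 1), r i + j) ?_ ?_ ?_
    · intro v hv
      have hg : Gap r v := (Finset.mem_filter.1 hv).2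
      rw [Finset.mem_powersetCard]
      constructor
      · intro x hx
        obtain ⟨j, -, rfl⟩ := Finset.mem_image.1 hx
        rw [Finset.mem_range]
        refine (hg.strictMono.monotone (Fin.le_last j)).trans_lt ?_
        have h1 := hg.sum_le (Fin.last k)
        have h2 := hg.2.2
        simp only [Fin.val_last] at h1 ⊢
        omega
      · rw [Finset.card_image_of_injective _ hg.strictMono.injective]
        simp
    · intro v hv w hw he
      have hg : Gap r v := (Finset.mem_filter.1 hv).2
      have hg' : Gap r w := (Finset.mem_filter.1 hw).2
      have he' := congrArg (fun s : Finset ℕ => (s : Set ℕ)) he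
      simp only [Finset.coe_image, Finset.coe_univ, Set.image_univ] at he'
      have hf := (hg.strictMono.range_inj hg'.strictMono).1 he'
      funext j
      have h1 := congrFun hf j
      have h2 := hg.sum_le j
      have h3 := hg'.sum_le j
      apply Fin.ext
      omega
    · intro s hs
      rw [Finset.mem_powersetCard] at hs
      set x := s.orderEmbOfFin hs.2 with hx
      have hxlt : ∀ j, x j < M - 1 - c + (k + 1) := fun j =>
        Finset.mem_range.1 (hs.1 (Finset.orderEmbOfFin_mem s hs.2 j))
      have hxs : ∀ j : Fin k, x j.castSucc < x j.succ := fun j =>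
        x.strictMono (Fin.castSucc_lt_succ)
      have hxj : ∀ j : Fin (k + 1), (j : ℕ) ≤ x j := by
        intro j
        induction j using Fin.induction with
        | zero => simp
        | succ j ih =>
          have := hxs j
          simp only [Fin.val_castSucc, Fin.val_succ] at ih ⊢
          omega
      have hstep : ∀ j : Fin k, x j.castSucc - j + (∑ i ∈ Finset.range (j + 1), r i) + r (j + 1) ≤
          x j.succ - (j + 1) + ∑ i ∈ Finset.range (j + 1 + 1), r i := by
        intro j
        have h1 := hxs j
        have h2 := hxj j.castSucc
        rw [Finset.sum_range_succ _ (j + 1 : ℕ)]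
        simp only [Fin.val_castSucc] at h2
        omega
      have hlast : x (Fin.last k) - k + (∑ i ∈ Finset.range (k + 1), r i) + r (k + 1) < M := by
        have h1 := hxlt (Fin.last k)
        omega
      have hmono : Monotone fun j : Fin (k + 1) =>
          x j - j + ∑ i ∈ Finset.range ((j : ℕ) + 1), r i := by
        rw [Fin.monotone_iff_le_succ]
        intro j
        have := hstep j
        simp only [Fin.val_castSucc, Fin.val_succ]
        omega
      have hyM : ∀ j : Fin (k + 1), x j - j + ∑ i ∈ Finset.range ((j : ℕ) + 1), r i < M := by
        intro j
        refine (hmono (Fin.le_last j)).trans_lt ?_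
        simp only [Fin.val_last]
        omega
      refine ⟨fun j => ⟨_, hyM j⟩, Finset.mem_filter.2 ⟨Finset.mem_univ _, ?_, ?_, ?_⟩, ?_⟩
      · simp
      · intro j
        have := hstep j
        simpa only [Fin.val_castSucc, Fin.val_succ] using this
      · simpa only [Fin.val_last] using hlast
      · have hfun : (fun j : Fin (k + 1) => x j - (j : ℕ) + (∑ i ∈ Finset.range ((j : ℕ) + 1), r i) -
            (∑ i ∈ Finset.range ((j : ℕ) + 1), r i) + j) = x := by
          funext j
          have := hxj j
          omega
        simp only [hfun]
        exact Finset.image_orderEmbOfFin_univ s hs.2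
  · rw [Finset.card_eq_zero, Finset.filter_eq_empty_iff]
    intro v _ hg
    have h1 := hg.sum_le (Fin.last k)
    have h2 := hg.2.2
    simp only [Fin.val_last] at h1
    omega

/-- Here σ lists the positions 0, …, k by increasing rank. Compatibility need only be tested on
neighbours in this list, where equality of letters is forbidden exactly when the ranks of the
successors descend. Neither r nor σ depends on M. -/
theorem exists_admissible_iff_gap (π : Equiv.Perm (Fin (k + 2))) :
    ∃ (r : ℕ → ℕ) (σ : Equiv.Perm (Fin (k + 1))), ∀ (M : ℕ) (U : Fin (k + 1) → Fin M),
      Admissible π U ↔ Gap r (U ∘ σ) := by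
  obtain ⟨ρ, hρ⟩ := exists_perm_lt_iff (fun i : Fin (k + 1) => π i.castSucc)
    (π.injective.comp (Fin.castSucc_injective _))
  set σ := ρ.symm with hσ
  have hrσ : ∀ a b : Fin (k + 1), rank π (σ a) < rank π (σ b) ↔ a < b := by
    intro a b
    have h := hρ (σ a) (σ b)
    simp only [hσ, Equiv.apply_symm_apply] at h
    rw [h, ← Fin.val_fin_lt, ← rank_val π, ← rank_val π]
    simp only [hσ, Fin.val_castSucc]
  have hDne : ∀ a b : Fin (k + 1), a ≠ b → rank π (σ a + 1) ≠ rank π (σ b + 1) := by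
    intro a b hab h
    have := distinct_rank π _ (by omega) _ (by omega) h
    exact hab (σ.injective (Fin.ext (by omega)))
  set s : ℕ → Fin (k + 1) := fun i => σ (Fin.ofNat (k + 1) i) with hs
  have hs' : ∀ j : Fin (k + 1), s j = σ j := fun j => by simp [hs]
  refine ⟨fun i => if i = 0 then (if rank π (k + 1) = 0 ∧ (σ 0 : ℕ) = k then 1 else 0) else
    if i = k + 1 then (if rank π (k + 1) = k + 1 ∧ (σ (Fin.last k) : ℕ) = k then 1 else 0) else
    if rank π (s i + 1) < rank π (s (i - 1) + 1) then 1 else 0, σ, fun M U => ?_⟩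
  have hC : Compat (k + 1) (rank π) (letters U) ↔ ∀ j : Fin k, ((U ∘ σ) j.castSucc : ℕ) +
      (if rank π (σ j.succ + 1) < rank π (σ j.castSucc + 1) then 1 else 0) ≤ (U ∘ σ) j.succ := by
    have h1 : Compat (k + 1) (rank π) (letters U) ↔ StrictMono fun a : Fin (k + 1) =>
        toLex (((U ∘ σ) a : ℕ), rank π (σ a + 1)) := by
      constructor
      · intro h a b hab
        have := h (σ a) (σ a).2 (σ b) (σ b).2 ((hrσ a b).2 hab)
        rw [letters_val, letters_val] at this
        rwa [Prod.Lex.toLex_lt_toLex]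
      · intro h i hi j hj hij
        obtain ⟨a, ha⟩ := σ.surjective ⟨i, hi⟩
        obtain ⟨b, hb⟩ := σ.surjective ⟨j, hj⟩
        obtain rfl : (σ a : ℕ) = i := by rw [ha]
        obtain rfl : (σ b : ℕ) = j := by rw [hb]
        have := h ((hrσ a b).1 hij)
        rw [Prod.Lex.toLex_lt_toLex] at this
        rwa [letters_val, letters_val]
    rw [h1, Fin.strictMono_iff_lt_succ]
    refine forall_congr' fun j => ?_
    have h2 := hDne j.castSucc j.succ (Fin.castSucc_lt_succ).ne
    rw [Prod.Lex.toLex_lt_toLex]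
    simp only
    split_ifs <;> omega
  have hmid : ∀ j : Fin k, (if ((j : ℕ) + 1) = 0 then
      (if rank π (k + 1) = 0 ∧ (σ 0 : ℕ) = k then 1 else 0) else
      if (j : ℕ) + 1 = k + 1 then
        (if rank π (k + 1) = k + 1 ∧ (σ (Fin.last k) : ℕ) = k then 1 else 0) else
      if rank π (s (j + 1) + 1) < rank π (s (j + 1 - 1) + 1) then 1 else 0) =
      if rank π (σ j.succ + 1) < rank π (σ j.castSucc + 1) then 1 else 0 := by
    intro j
    have hj := j.2
    rw [if_neg (by omega), if_neg (by omega), Nat.add_sub_cancel]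
    have h1 := hs' j.succ
    have h2 := hs' j.castSucc
    simp only [Fin.val_succ, Fin.val_castSucc] at h1 h2
    rw [h1, h2]
  unfold Gap
  simp only [hmid]
  rw [if_pos trivial, if_neg (show k + 1 ≠ 0 by omega), if_pos trivial, ← hC, Admissible]
  have hUk : ∀ a : Fin (k + 1), (σ a : ℕ) = k → letters U k = U (σ a) := by
    intro a ha
    rw [← letters_val U (σ a)]
    exact congrArg (letters U) ha.symm
  constructor
  · rintro ⟨h, hlo, hhi⟩
    refine ⟨?_, h, ?_⟩
    · split_ifs with h0
      · have := hlo h0.1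
        rw [hUk _ h0.2] at this
        exact Nat.one_le_iff_ne_zero.2 this
      · exact Nat.zero_le _
    · have hv := (U (σ (Fin.last k))).2
      split_ifs with h0
      · have := hhi h0.1
        rw [hUk _ h0.2] at this
        simp only [Function.comp_apply]
        omega
      · exact hv
  · rintro ⟨hlo, h, hhi⟩
    refine ⟨h, fun h0 hU => ?_, fun h0 hU => ?_⟩
    -- The end condition needs its own increment only when position k heads the list. Otherwise a
    -- letter 0 at k would force `σ 0` to have letter 0 and its successor a rank below 0.
    · have hne : (σ 0 : ℕ) ≠ k := by
        intro hk
        rw [if_pos ⟨h0, hk⟩] at hlo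
        rw [hUk _ hk] at hU
        simp only [Function.comp_apply] at hlo
        omega
      obtain ⟨b, hb⟩ := σ.surjective (Fin.last k)
      have hbk : (σ b : ℕ) = k := by rw [hb]; rfl
      have hb0 : 0 < b := by
        rw [Fin.pos_iff_ne_zero]
        rintro rfl
        exact hne hbk
      have h3 := (hrσ 0 b).2 hb0
      rw [hbk] at h3
      rcases h _ (σ 0).2 k (by omega) h3 with h4 | ⟨-, h4⟩ <;> omega
    · have hne : (σ (Fin.last k) : ℕ) ≠ k := by
        intro hk
        rw [if_pos ⟨h0, hk⟩] at hhi
        rw [hUk _ hk] at hU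
        simp only [Function.comp_apply] at hhi
        omega
      obtain ⟨b, hb⟩ := σ.surjective (Fin.last k)
      have hbk : (σ b : ℕ) = k := by rw [hb]; rfl
      have hb0 : b < Fin.last k := by
        rw [Fin.lt_last_iff_ne_last]
        rintro rfl
        exact hne hbk
      have h3 := (hrσ b (Fin.last k)).2 hb0
      rw [hbk] at h3
      have h5 := letters_lt U (σ (Fin.last k))
      have h6 := rank_lt_succ π (σ (Fin.last k) + 1)
      rcases h k (by omega) _ (σ (Fin.last k)).2 h3 with h4 | ⟨-, h4⟩ <;> omega

open scoped Classical in
theorem exists_card_admissible (π : Equiv.Perm (Fin (k + 2))) :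
    ∃ c : ℕ, ∀ M : ℕ, (Finset.univ.filter fun U : Fin (k + 1) → Fin M => Admissible π U).card =
      if c < M then (M - 1 - c + (k + 1)).choose (k + 1) else 0 := by
  obtain ⟨r, σ, h⟩ := exists_admissible_iff_gap π
  refine ⟨_, fun M => (?_ : _ = _).trans (card_gap r)⟩
  refine Finset.card_equiv (σ.symm.arrowCongr (Equiv.refl (Fin M))) fun U => ?_
  simp only [Finset.mem_filter, Finset.mem_univ, true_and, h]
  rfl

end Gaps

/-! ### Inversion -/

/-- The coefficient of `X ^ d` in `(1 - X) ^ (k + 2) * (X ^ c * (1 - X) ^ (-(k + 2)))`. -/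
theorem alternating_sum_choose (k c d : ℕ) :
    ∑ i ∈ Finset.range (d + 1), (-1 : ℤ) ^ i * ((k + 2).choose i : ℤ) *
      (if c ≤ d - i then ((d - i - c + (k + 1)).choose (k + 1) : ℤ) else 0) =
    if d = c then 1 else 0 := by
  have h1 : ((1 - PowerSeries.X : PowerSeries ℤ) ^ (k + 2)) *
      (PowerSeries.X ^ c * (PowerSeries.invOneSubPow ℤ (k + 2)).val) = PowerSeries.X ^ c := by
    rw [mul_left_comm, ← PowerSeries.invOneSubPow_inv_eq_one_sub_pow, Units.inv_val, mul_one]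
  have h2 := congrArg (PowerSeries.coeff d) h1
  rw [PowerSeries.coeff_X_pow, PowerSeries.coeff_mul,
    Finset.Nat.sum_antidiagonal_eq_sum_range_succ_mk] at h2
  rw [← h2]
  refine Finset.sum_congr rfl fun i hi => ?_
  congr 1
  · have h3 : (1 - PowerSeries.X : PowerSeries ℤ) ^ (k + 2) = PowerSeries.rescale (-1)
        (((1 + Polynomial.X : Polynomial ℤ) ^ (k + 2) : Polynomial ℤ) : PowerSeries ℤ) := by
      simp [PowerSeries.rescale_X, sub_eq_add_neg]
    rw [h3, PowerSeries.coeff_rescale, Polynomial.coeff_coe, Polynomial.coeff_one_add_X_pow]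
  · rw [PowerSeries.coeff_X_pow_mul', PowerSeries.invOneSubPow_val_succ_eq_mk_add_choose,
      PowerSeries.coeff_mk, add_comm]

/-! ### Counting permutations by the number of symbols they need -/

section Main

variable {k : ℕ}

open scoped Classical in
theorem mem_allowedPatterns_iff_card_pos {M : ℕ} (π : Equiv.Perm (Fin (k + 2))) :
    π ∈ allowedPatterns (shift M) (k + 2) ↔
      0 < (Finset.univ.filter fun U : Fin (k + 1) → Fin M => Admissible π U).card := by
  rw [mem_allowedPatterns_iff, Finset.card_pos, Finset.filter_nonempty_iff]
  simp

/-- Permutations of length at least two need at least two symbols. -/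
theorem not_mem_allowedPatterns_one (π : Equiv.Perm (Fin (k + 2))) :
    π ∉ allowedPatterns (shift 1) (k + 2) := by
  rintro ⟨w, hw⟩
  have hne : π 0 ≠ π 1 := π.injective.ne (by simp)
  have h : ∀ v v' : Word 1, ¬ v < v' := by
    rintro v v' ⟨i, -, hi⟩
    exact hi.ne (Subsingleton.elim _ _)
  rcases lt_or_gt_of_ne hne with h' | h'
  · exact h _ _ ((hw 0 1).2 h')
  · exact h _ _ ((hw 1 0).2 h')

open scoped Classical in
theorem sum_card_admissible_int {M : ℕ} (hM : 1 ≤ M) :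
    ∑ π : Equiv.Perm (Fin (k + 2)),
      ((Finset.univ.filter fun U : Fin (k + 1) → Fin M => Admissible π U).card : ℤ) =
    ((M : ℤ) - 2) * (M : ℤ) ^ k +
      ∑ t ∈ Finset.Icc 1 (k + 1), (numPrimitive M t : ℤ) * (M : ℤ) ^ (k + 1 - t) := by
  have h := congrArg (Nat.cast (R := ℤ)) (sum_card_admissible (k := k) hM)
  simp only [Finset.card_filter] at h ⊢
  rw [Finset.sum_comm] at h
  push_cast at h ⊢
  rw [pow_succ] at h
  linear_combination h

theorem numPerms_eq_sum (N : ℕ) (hN : 2 ≤ N) :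
    (numPerms (k + 2) N : ℤ) =
      ∑ i ∈ Finset.range (N - 1), (-1 : ℤ) ^ i * ((k + 2).choose i : ℤ) *
        (((N - i : ℕ) - 2 : ℤ) * ((N - i : ℕ) : ℤ) ^ k +
          ∑ t ∈ Finset.Icc 1 (k + 1),
            (numPrimitive (N - i) t : ℤ) * ((N - i : ℕ) : ℤ) ^ (k + 1 - t)) := by
  classical
  choose c hc using exists_card_admissible (k := k)
  have hmem : ∀ (π : Equiv.Perm (Fin (k + 2))) (M : ℕ),
      π ∈ allowedPatterns (shift M) (k + 2) ↔ c π < M := by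
    intro π M
    rw [mem_allowedPatterns_iff_card_pos, hc]
    split_ifs with h
    · exact iff_of_true (Nat.choose_pos (by omega)) h
    · exact iff_of_false (lt_irrefl _) h
  have hsym : ∀ π : Equiv.Perm (Fin (k + 2)), symbolsNeeded π = c π + 1 := by
    intro π
    have h : {M : ℕ | π ∈ allowedPatterns (shift M) (k + 2)} = Set.Ici (c π + 1) := by
      ext M
      exact (hmem π M).trans Nat.lt_iff_add_one_le
    rw [symbolsNeeded, h, csInf_Ici]
  obtain ⟨d, rfl⟩ : ∃ d, N = d + 1 := ⟨N - 1, by omega⟩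
  have hleft : (numPerms (k + 2) (d + 1) : ℤ) =
      ∑ π : Equiv.Perm (Fin (k + 2)), if d = c π then (1 : ℤ) else 0 := by
    rw [numPerms, Nat.card_eq_fintype_card, Fintype.card_subtype, Finset.card_filter]
    push_cast
    refine Finset.sum_congr rfl fun π _ => if_congr ?_ rfl rfl
    rw [hsym]
    omega
  -- The term i = N-1 of the inversion concerns a one-letter alphabet and vanishes, so the sum stops
  -- at N-2.
  have hone : ∑ π : Equiv.Perm (Fin (k + 2)),
      ((Finset.univ.filter fun U : Fin (k + 1) → Fin 1 => Admissible π U).card : ℤ) = 0 := by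
    refine Finset.sum_eq_zero fun π _ => ?_
    have h := not_mem_allowedPatterns_one π
    rw [mem_allowedPatterns_iff_card_pos] at h
    exact_mod_cast Nat.eq_zero_of_not_pos h
  have hright : ∑ i ∈ Finset.range (d + 1), (-1 : ℤ) ^ i * ((k + 2).choose i : ℤ) *
      ∑ π : Equiv.Perm (Fin (k + 2)),
        ((Finset.univ.filter fun U : Fin (k + 1) → Fin (d + 1 - i) => Admissible π U).card : ℤ) =
      ∑ π : Equiv.Perm (Fin (k + 2)), if d = c π then (1 : ℤ) else 0 := by
    simp only [Finset.mul_sum]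
    rw [Finset.sum_comm]
    refine Finset.sum_congr rfl fun π _ => ?_
    rw [← alternating_sum_choose k (c π) d]
    refine Finset.sum_congr rfl fun i hi => ?_
    have hi' := Finset.mem_range.1 hi
    rw [hc, show d + 1 - i - 1 = d - i by omega]
    by_cases h : c π ≤ d - i
    · rw [if_pos h, if_pos (by omega)]
    · rw [if_neg h, if_neg (by omega), Nat.cast_zero]
  rw [hleft, ← hright, Finset.sum_range_succ, show d + 1 - d = 1 by omega, hone, mul_zero, add_zero,
    Nat.add_sub_cancel]
  refine Finset.sum_congr rfl fun i hi => ?_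
  rw [sum_card_admissible_int]
  have := Finset.mem_range.1 hi
  omega

end Main

end ShiftPatterns

theorem mainTheorem2 (n N : ℕ) (hn : 2 ≤ n) (hN : 2 ≤ N) :
    (ShiftPatterns.numPerms n N : ℤ) =
      ∑ i ∈ Finset.range (N - 1), (-1 : ℤ) ^ i * (n.choose i : ℤ) *
        (((N : ℤ) - (i : ℤ) - 2) * ((N : ℤ) - (i : ℤ)) ^ (n - 2) +
          ∑ t ∈ Finset.Icc 1 (n - 1),
            (ShiftPatterns.numPrimitive (N - i) t : ℤ) * ((N : ℤ) - (i : ℤ)) ^ (n - t - 1)) := by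
  obtain ⟨k, rfl⟩ : ∃ k, n = k + 2 := ⟨n - 2, by omega⟩
  rw [ShiftPatterns.numPerms_eq_sum N hN]
  refine Finset.sum_congr rfl fun i hi => ?_
  have hi' := Finset.mem_range.1 hi
  rw [Nat.cast_sub (show i ≤ N by omega), Nat.add_sub_cancel, show k + 2 - 1 = k + 1 by omega]
  congr 2
  refine Finset.sum_congr rfl fun t _ => ?_
  rw [show k + 2 - t - 1 = k + 1 - t by omega]
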